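/- For $d \ge 2$, let $\mathcal{R}_{\mathrm{ST}}$ be the family of all axis-aligned strips $\{x \in \mathbb{R}^d : a \le x_i \le b\}$ with $1 \le i \le d$ and $a, b \in \mathbb{R}$. For a finite set $V \subset \mathbb{R}^d$ and an integer $m$, let $\mathcal{H}(V, \mathcal{R}_{\mathrm{ST}}, m)$ be the hypergraph on the vertex set $V$ whose hyperedges are the sets $e$ with $|e| = m$ that are of the form $e = V \cap R$ for some $R \in \mathcal{R}_{\mathrm{ST}}$. A coloring $V \to \{1, \dots, k\}$ is called polychromatic if every hyperedge contains all $k$ colors. Let $m_d(k) = m_{\mathcal{R}_{\mathrm{ST}}}(k)$ be the smallest integer $m \ge 0$ such that for every finite set $V \subset \mathbb{R}^d$ the hypergraph $\mathcal{H}(V, \mathcal{R}_{\mathrm{ST}}, m)$ has a polychromatic $k$-coloring ($m_d(k) = \infty$ if there is no such $m$). Then $m_d(k) \le 2k(\ln d + O(\ln\ln d))$. That is, there is an absolute constant $C$ such that for all integers $d \ge 2$ and $k \ge 2$, the number $m_d(k)$ is finite and $$m_d(k) \le 2k\,\bigl(\ln d + C\,|\ln\ln d|\bigr).$$ -/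

import Mathlib

/-- The hyperedges of the range capturing hypergraph `ℋ(V, R)`: the subsets `e` of the finite
point set `V` of the form `e = V ∩ r` for a range `r` of the range family `R`. -/
def capturedEdges {X : Type*} (V : Finset X) (R : Set (Set X)) : Set (Finset X) :=
  {e | ∃ r ∈ R, (e : Set X) = (V : Set X) ∩ r}

/-- The hyperedges of the `m`-uniform subhypergraph `ℋ(V, R, m)`: the hyperedges of `ℋ(V, R)`
of size exactly `m`. -/
def uniformCapturedEdges {X : Type*} (V : Finset X) (R : Set (Set X)) (m : ℕ) :
    Set (Finset X) :=
  {e | e ∈ capturedEdges V R ∧ e.card = m}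

/-- The `k`-coloring `c` of the vertex set `V` is polychromatic for the hyperedge set `E`:
every hyperedge contains all `k` colors. -/
def IsPolychromatic {X : Type*} {V : Finset X} {k : ℕ} (c : {v // v ∈ V} → Fin k)
    (E : Set (Finset X)) : Prop :=
  ∀ e ∈ E, ∀ i : Fin k, ∃ v : {v // v ∈ V}, (v : X) ∈ e ∧ c v = i

/-- `m` is good for `R` and `k`: for every finite point set `V`, the hypergraph `ℋ(V, R, m)`
has a polychromatic `k`-coloring. -/
def HasPolychromaticColorings {X : Type*} (R : Set (Set X)) (k m : ℕ) : Prop :=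
  ∀ V : Finset X, ∃ c : {v // v ∈ V} → Fin k, IsPolychromatic c (uniformCapturedEdges V R m)

/-- `m_R(k)`: the smallest natural number `m` such that for every finite point set `V` the
hypergraph `ℋ(V, R, m)` has a polychromatic `k`-coloring, and `∞` if there is no such `m`. -/
noncomputable def polychromaticNumber {X : Type*} (R : Set (Set X)) (k : ℕ) : ℕ∞ :=
  sInf {N : ℕ∞ | ∃ m : ℕ, N = (m : ℕ∞) ∧ HasPolychromaticColorings R k m}

/-- The range family of all axis-aligned strips `{x | a ≤ x i ≤ b}` in `ℝ^d`. -/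
def axisStrips (d : ℕ) : Set (Set (Fin d → ℝ)) :=
  {s | ∃ (i : Fin d) (a b : ℝ), s = {x | a ≤ x i ∧ x i ≤ b}}

/-! In each direction, sort the points and cut the order into consecutive blocks of size `s`. A
strip with `2 * s` points captures an interval of one of these orders, hence a whole block, and each
point lies in at most `d` blocks. So it suffices to color hypergraphs of degree at most `d` with
edges of size about `k * (log d + O(log log d))`.

With `L = log d` large, a uniformly random coloring and the local lemma suffice for `k ≤ L ^ 8`: the
union bound over the colors costs only a power of `L`, paid for by the `log log d` term. For larger
`k` the local lemma gives a nearly balanced 2-coloring of every edge; each class is then colored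
with its own half of the palette. The deviations must not accumulate over the halvings. The
induction therefore proves the stronger bound `k * M - k ^ (3 / 4)`: as `x ^ (3 / 4)` is concave,
halving `k` frees a fixed fraction of `k ^ (3 / 4)`, more than the deviation of order `√(s * log (s
* d))`. -/

/-! ### The local lemma and random colorings, by counting. -/

/-- The symmetric Lovász local lemma on a finite uniform probability space, in counting form:
`N i` is the set of indices on which the event `A i` may depend. -/
theorem exists_avoid_of_local_lemma {Ω ι : Type*} [Fintype Ω] [Nonempty Ω] [Fintype ι]
    [DecidableEq ι] (A : ι → Ω → Prop) (N : ι → Finset ι) (D : ℕ) (p : ℝ) (hp : 0 ≤ p)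
    (hD : 1 ≤ D) (hpD : 4 * p * D ≤ 1) (hN : ∀ i, (N i).card ≤ D)
    (hind : ∀ i, ∀ S : Finset ι, Disjoint S (N i) →
      (Nat.card {ω // A i ω ∧ ∀ j ∈ S, ¬ A j ω} : ℝ) ≤
        p * Nat.card {ω // ∀ j ∈ S, ¬ A j ω}) :
    ∃ ω, ∀ i, ¬ A i ω := by
  classical
  simp only [Nat.card_eq_fintype_card, Fintype.card_subtype] at hind
  have hp4 : 4 * p ≤ 1 := by
    have : (1 : ℝ) ≤ D := by exact_mod_cast hD
    nlinarith
  set a : Finset ι → ℝ := fun S => ((Finset.univ.filter fun ω => ∀ j ∈ S, ¬ A j ω).card : ℝ)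
    with ha
  set b : ι → Finset ι → ℝ := fun i S =>
    ((Finset.univ.filter fun ω => A i ω ∧ ∀ j ∈ S, ¬ A j ω).card : ℝ) with hb
  -- Given that the events in `S` are avoided, `A i` has conditional probability at most `2 * p`.
  have hcond : ∀ n, ∀ S : Finset ι, S.card = n → ∀ i, b i S ≤ 2 * p * a S := by
    intro n
    induction n using Nat.strong_induction_on with
    | _ n ih =>
      intro S hS i
      by_cases hdis : Disjoint S (N i)
      · have h0 : (0 : ℝ) ≤ a S := Nat.cast_nonneg _
        have := hind i S hdis
        change b i S ≤ p * a S at this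
        nlinarith [mul_nonneg hp h0]
      · have hlt : (S \ N i).card < S.card := by
          apply Finset.card_lt_card
          refine ⟨Finset.sdiff_subset, fun h => hdis ?_⟩
          exact Finset.disjoint_of_subset_left h Finset.sdiff_disjoint
        have h1 : b i S ≤ b i (S \ N i) := by
          simp only [hb]
          exact_mod_cast Finset.card_le_card fun ω hω => by
            simp only [Finset.mem_filter, Finset.mem_univ, true_and, Finset.mem_sdiff] at hω ⊢
            exact ⟨hω.1, fun j hj => hω.2 j hj.1⟩
        have h2 : b i (S \ N i) ≤ p * a (S \ N i) := hind i _ Finset.sdiff_disjoint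
        have h3 : a (S \ N i) ≤ a S + ∑ j ∈ N i, b j (S \ N i) := by
          simp only [ha, hb]
          have : (Finset.univ.filter fun ω => ∀ j ∈ S \ N i, ¬ A j ω) ⊆
              (Finset.univ.filter fun ω => ∀ j ∈ S, ¬ A j ω) ∪ (N i).biUnion fun l =>
                Finset.univ.filter fun ω => A l ω ∧ ∀ j ∈ S \ N i, ¬ A j ω := by
            intro ω hω
            simp only [Finset.mem_filter, Finset.mem_univ, true_and, Finset.mem_union,
              Finset.mem_biUnion] at hω ⊢
            by_contra! hcon
            obtain ⟨⟨j, hj, hAj⟩, hcon⟩ := hcon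
            by_cases hjN : j ∈ N i
            · obtain ⟨l, hl, hAl⟩ := hcon j hjN hAj
              exact hω l hl hAl
            · exact hω j (Finset.mem_sdiff.2 ⟨hj, hjN⟩) hAj
          have h := (Finset.card_le_card this).trans (Finset.card_union_le _ _)
          have h' := h.trans (Nat.add_le_add_left Finset.card_biUnion_le _)
          exact_mod_cast h'
        have h4 : ∑ j ∈ N i, b j (S \ N i) ≤ D * (2 * p * a (S \ N i)) := by
          refine (Finset.sum_le_card_nsmul _ _ _
            fun j _ => ih _ (hS ▸ hlt) (S \ N i) rfl j).trans ?_
          rw [nsmul_eq_mul]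
          have h0 : (0 : ℝ) ≤ a (S \ N i) := Nat.cast_nonneg _
          have : ((N i).card : ℝ) ≤ D := by exact_mod_cast hN i
          gcongr
        have h0 : (0 : ℝ) ≤ a (S \ N i) := Nat.cast_nonneg _
        -- The at most `D` neighbors have total conditional probability at most `2 * p * D ≤ 1 / 2`.
        have h5 : a (S \ N i) ≤ 2 * a S := by nlinarith
        nlinarith
  have hpos : ∀ S : Finset ι, 0 < a S := by
    intro S
    induction S using Finset.induction_on with
    | empty => simp [ha, Fintype.card_pos]
    | insert j S _ ih =>
      have h1 := hcond _ S rfl j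
      have h2 : a S ≤ a (insert j S) + b j S := by
        simp only [ha, hb]
        have : (Finset.univ.filter fun ω => ∀ l ∈ S, ¬ A l ω) ⊆
            (Finset.univ.filter fun ω => ∀ l ∈ insert j S, ¬ A l ω) ∪
              (Finset.univ.filter fun ω => A j ω ∧ ∀ l ∈ S, ¬ A l ω) := by
          intro ω hω
          simp only [Finset.mem_filter, Finset.mem_univ, true_and, Finset.mem_union,
            Finset.forall_mem_insert] at hω ⊢
          tauto
        exact_mod_cast (Finset.card_le_card this).trans (Finset.card_union_le _ _)
      nlinarith
  have h := hpos Finset.univ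
  simp only [ha, Nat.cast_pos, Finset.card_pos] at h
  obtain ⟨ω, hω⟩ := h
  exact ⟨ω, by simpa using hω⟩

/-- Events depending on disjoint sets of coordinates are independent. -/
theorem card_and_mul_card_eq {V K : Type*} [Fintype V] [Fintype K] [DecidableEq V]
    (e : Finset V) (A B : (V → K) → Prop)
    (hA : ∀ f g : V → K, (∀ v ∈ e, f v = g v) → A f → A g)
    (hB : ∀ f g : V → K, (∀ v, v ∉ e → f v = g v) → B f → B g) :
    Nat.card {f // A f ∧ B f} * Nat.card (V → K) = Nat.card {f // A f} * Nat.card {f // B f} := by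
  classical
  simp only [Nat.card_eq_fintype_card, Fintype.card_subtype]
  rw [← Finset.card_univ, ← Finset.card_product, ← Finset.card_product]
  -- Swapping the values on `e` between two colorings is an involution; it moves the condition `B`
  -- to the second one.
  refine Finset.card_nbij' (fun q => (e.piecewise q.1 q.2, e.piecewise q.2 q.1))
    (fun q => (e.piecewise q.1 q.2, e.piecewise q.2 q.1)) ?_ ?_ ?_ ?_
  · rintro ⟨f, g⟩ h
    simp only [Finset.coe_product, Set.mem_prod, Finset.mem_coe, Finset.mem_filter,
      Finset.mem_univ, true_and, and_true] at h ⊢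
    exact ⟨hA f _ (fun v hv => by simp [hv]) h.1, hB f _ (fun v hv => by simp [hv]) h.2⟩
  · rintro ⟨f, g⟩ h
    simp only [Finset.coe_product, Set.mem_prod, Finset.mem_coe, Finset.mem_filter,
      Finset.mem_univ, true_and, and_true] at h ⊢
    exact ⟨hA f _ (fun v hv => by simp [hv]) h.1, hB g _ (fun v hv => by simp [hv]) h.2⟩
  all_goals
    rintro ⟨f, g⟩ -
    ext v
    all_goals by_cases hv : v ∈ e <;> simp [hv]

/-- The local lemma for vertex colorings of a hypergraph with edges of size at most `s` and vertex
degrees at most `d`, where the bad event of an edge depends only on the colors of its vertices. -/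
theorem exists_coloring_of_local_lemma {V K ι : Type*} [Fintype V] [Fintype K] [Nonempty K]
    [Fintype ι] [DecidableEq V] (E : ι → Finset V) (s d : ℕ) (hs : 1 ≤ s) (hd : 1 ≤ d)
    (hE : ∀ i, (E i).card ≤ s) (hdeg : ∀ v, Nat.card {i // v ∈ E i} ≤ d)
    (A : ι → (V → K) → Prop)
    (hA : ∀ i, ∀ f g : V → K, (∀ v ∈ E i, f v = g v) → A i f → A i g)
    (hp : ∀ i, 4 * (s * d : ℝ) * Nat.card {f // A i f} ≤ Nat.card (V → K)) :
    ∃ f, ∀ i, ¬ A i f := by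
  classical
  have hsd : (0 : ℝ) < s * d := by
    have : 0 < s * d := Nat.mul_pos hs hd
    exact_mod_cast this
  have hK : (0 : ℝ) < Nat.card (V → K) := by exact_mod_cast Nat.card_pos
  refine exists_avoid_of_local_lemma A
    (fun i => (E i).biUnion fun v => Finset.univ.filter fun j => v ∈ E j) (s * d)
    (1 / (4 * (s * d : ℝ))) (by positivity) (Nat.mul_pos hs hd) ?_ ?_ ?_
  · push_cast
    exact le_of_eq (by field_simp)
  · intro i
    refine (Finset.card_biUnion_le_card_mul _ _ d fun v _ => ?_).trans
      (Nat.mul_le_mul_right _ (hE i))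
    simpa [Nat.card_eq_fintype_card, Fintype.card_subtype] using hdeg v
  · intro i S hS
    have hind := card_and_mul_card_eq (E i) (A i) (fun f => ∀ j ∈ S, ¬ A j f) (hA i) (by
      intro f g hfg hf j hj hg
      refine hf j hj (hA j g f (fun v hv => (hfg v fun hvi => ?_).symm) hg)
      refine Finset.disjoint_left.1 hS hj ?_
      simp only [Finset.mem_biUnion, Finset.mem_filter, Finset.mem_univ, true_and]
      exact ⟨v, hvi, hv⟩)
    have hind' : (Nat.card {f // A i f ∧ ∀ j ∈ S, ¬ A j f} : ℝ) * Nat.card (V → K) =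
        Nat.card {f // A i f} * Nat.card {f // ∀ j ∈ S, ¬ A j f} := by exact_mod_cast hind
    have hpi := hp i
    have h0 : (0 : ℝ) ≤ Nat.card {f // ∀ j ∈ S, ¬ A j f} := Nat.cast_nonneg _
    rw [div_mul_eq_mul_div, le_div_iff₀ (by positivity), one_mul]
    refine le_of_mul_le_mul_right ?_ hK
    nlinarith [mul_le_mul_of_nonneg_right hpi h0]

/-- An exponential-moment bound for uniformly random colorings. -/
theorem mul_card_le_of_weight {V K : Type*} [Fintype V] [Fintype K] [Nonempty K] [DecidableEq V]
    (e : Finset V) (w : K → ℝ) (hw : ∀ c, 0 ≤ w c) (T : ℝ) (B : (V → K) → Prop)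
    (hB : ∀ f, B f → T ≤ ∏ v ∈ e, w (f v)) :
    T * Nat.card {f // B f} ≤ ((∑ c, w c) / Fintype.card K) ^ e.card * Nat.card (V → K) := by
  classical
  have hK : (Fintype.card K : ℝ) ≠ 0 := by exact_mod_cast Fintype.card_ne_zero
  -- Independence of the colors makes the mean of the product a product of means; Markov's
  -- inequality then gives the claim.
  have h1 : ∑ f : V → K, ∏ v ∈ e, w (f v) =
      ((∑ c, w c) / Fintype.card K) ^ e.card * Nat.card (V → K) := by
    have h2 : ∀ f : V → K, ∏ v ∈ e, w (f v) = ∏ v, if v ∈ e then w (f v) else 1 := by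
      intro f
      rw [Finset.prod_ite_mem, Finset.univ_inter]
    simp_rw [h2]
    have h3 := Finset.prod_univ_sum (fun _ : V => (Finset.univ : Finset K))
      (fun v c => if v ∈ e then w c else 1)
    rw [Fintype.piFinset_univ] at h3
    rw [← h3]
    have h4 : ∀ v : V, (∑ c, if v ∈ e then w c else 1) =
        (if v ∈ e then (∑ c, w c) / Fintype.card K else 1) * Fintype.card K := by
      intro v
      by_cases hv : v ∈ e
      · simp only [hv, if_true]
        field_simp
      · simp [hv]
    simp_rw [h4]
    rw [Finset.prod_mul_distrib, Finset.prod_ite_mem, Finset.univ_inter, Finset.prod_const,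
      Finset.prod_const, Nat.card_eq_fintype_card, Fintype.card_fun]
    simp
  rw [← h1, Nat.card_eq_fintype_card, Fintype.card_subtype, mul_comm, ← nsmul_eq_mul]
  refine (Finset.card_nsmul_le_sum _ (fun f => ∏ v ∈ e, w (f v)) T fun f hf => ?_).trans ?_
  · exact hB f (by simpa using hf)
  · exact Finset.sum_le_sum_of_subset_of_nonneg (Finset.subset_univ _)
      fun f _ _ => Finset.prod_nonneg fun v _ => hw _

/-! ### Polychromatic colorings of hypergraphs of bounded degree. -/

/-- Every finite hypergraph with edges of size at least `s` and vertex degrees at most `d` has a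
polychromatic `k`-coloring. -/
def BoundedDegreePolychromatic (d s k : ℕ) : Prop :=
  ∀ (V ι : Type) [Fintype V] [Fintype ι] (E : ι → Finset V), (∀ i, s ≤ (E i).card) →
    (∀ v, Nat.card {i // v ∈ E i} ≤ d) → ∃ c : V → Fin k, ∀ i a, ∃ v ∈ E i, c v = a

namespace BoundedDegreePolychromatic

theorem mono_size {d s s' k : ℕ} (h : BoundedDegreePolychromatic d s k) (hs : s ≤ s') :
    BoundedDegreePolychromatic d s' k :=
  fun V ι _ _ E hE hdeg => h V ι E (fun i => hs.trans (hE i)) hdeg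

theorem mono_degree {d d' s k : ℕ} (h : BoundedDegreePolychromatic d s k) (hd : d' ≤ d) :
    BoundedDegreePolychromatic d' s k :=
  fun V ι _ _ E hE hdeg => h V ι E hE (fun v => (hdeg v).trans hd)

theorem mono_colors {d s k k' : ℕ} (h : BoundedDegreePolychromatic d s k) (hk' : 1 ≤ k')
    (hk : k' ≤ k) : BoundedDegreePolychromatic d s k' := by
  intro V ι _ _ E hE hdeg
  obtain ⟨c, hc⟩ := h V ι E hE hdeg
  refine ⟨fun v => if hv : (c v : ℕ) < k' then ⟨c v, hv⟩ else ⟨0, hk'⟩, fun i a => ?_⟩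
  obtain ⟨v, hv, hva⟩ := hc i (Fin.castLE hk a)
  refine ⟨v, hv, ?_⟩
  simp [hva]

/-- Large edges may be shrunk, which does not raise degrees. The local lemma needs this, since its
dependency bound `s * d` requires an upper bound on edge sizes. -/
theorem of_card_eq {d s k : ℕ}
    (h : ∀ (V ι : Type) [Fintype V] [Fintype ι] (E : ι → Finset V), (∀ i, (E i).card = s) →
      (∀ v, Nat.card {i // v ∈ E i} ≤ d) → ∃ c : V → Fin k, ∀ i a, ∃ v ∈ E i, c v = a) :
    BoundedDegreePolychromatic d s k := by
  intro V ι _ _ E hE hdeg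
  choose E' hsub hcard using fun i => Finset.exists_subset_card_eq (hE i)
  obtain ⟨c, hc⟩ := h V ι E' hcard (fun v => (Nat.card_le_card_of_injective
    (fun i : {i // v ∈ E' i} => (⟨i.1, hsub i.1 i.2⟩ : {i // v ∈ E i}))
    (fun i j hij => Subtype.ext (by simpa using hij))).trans (hdeg v))
  exact ⟨c, fun i a => (hc i a).imp fun v hv => ⟨hsub i hv.1, hv.2⟩⟩

/-- A uniformly random coloring misses a given color on an edge with probability `(1 - 1 / k) ^ s ≤
exp (-(s / k))`; a union bound over colors precedes the local lemma. -/
theorem of_mul_exp_le {d s k : ℕ} (hd : 1 ≤ d) (hs : 1 ≤ s) (hk : 1 ≤ k)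
    (h : 4 * (s * d : ℝ) * (k * Real.exp (-(s / k))) ≤ 1) : BoundedDegreePolychromatic d s k := by
  classical
  refine of_card_eq fun V ι _ _ E hE hdeg => ?_
  have : Nonempty (Fin k) := ⟨⟨0, hk⟩⟩
  have hk0 : (0 : ℝ) < k := by exact_mod_cast hk
  obtain ⟨c, hc⟩ := exists_coloring_of_local_lemma (K := Fin k) E s d hs hd (fun i => (hE i).le)
    hdeg (fun i f => ∃ a, ∀ v ∈ E i, f v ≠ a)
    (fun i f g hfg ⟨a, ha⟩ => ⟨a, fun v hv => hfg v hv ▸ ha v hv⟩) (by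
      intro i
      have h1 : ∀ a : Fin k, (Nat.card {f : V → Fin k // ∀ v ∈ E i, f v ≠ a} : ℝ) ≤
          Real.exp (-(s / k)) * Nat.card (V → Fin k) := by
        intro a
        have h2 := mul_card_le_of_weight (E i) (fun c : Fin k => if c = a then (0 : ℝ) else 1)
          (fun c => by positivity) 1 (fun f => ∀ v ∈ E i, f v ≠ a) (fun f hf => by
            rw [Finset.prod_congr rfl fun v hv => if_neg (hf v hv)]
            simp)
        rw [one_mul, hE i] at h2
        refine h2.trans (mul_le_mul_of_nonneg_right ?_ (Nat.cast_nonneg _))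
        have h3 : (∑ c : Fin k, if c = a then (0 : ℝ) else 1) = k - 1 := by
          have : ∀ c : Fin k, (if c = a then (0 : ℝ) else 1) = 1 - if c = a then 1 else 0 := by
            intro c; split_ifs <;> simp
          simp_rw [this]
          simp
        rw [h3, Fintype.card_fin, show -((s : ℝ) / k) = s * (-(1 / k)) by ring, Real.exp_nat_mul]
        have hk1 : (1 : ℝ) ≤ k := by exact_mod_cast hk
        refine pow_le_pow_left₀ (div_nonneg (by linarith) hk0.le) ?_ _
        have := Real.add_one_le_exp (-(1 / (k : ℝ)))
        refine le_trans (le_of_eq ?_) this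
        field_simp
        ring
      have h4 : (Nat.card {f : V → Fin k // ∃ a, ∀ v ∈ E i, f v ≠ a} : ℝ) ≤
          k * (Real.exp (-(s / k)) * Nat.card (V → Fin k)) := by
        have h5 : Nat.card {f : V → Fin k // ∃ a, ∀ v ∈ E i, f v ≠ a} ≤
            ∑ a : Fin k, Nat.card {f : V → Fin k // ∀ v ∈ E i, f v ≠ a} := by
          simp only [Nat.card_eq_fintype_card, Fintype.card_subtype]
          refine le_trans (Finset.card_le_card fun f hf => ?_) Finset.card_biUnion_le
          simpa using hf
        have h6 : (∑ a : Fin k, (Nat.card {f : V → Fin k // ∀ v ∈ E i, f v ≠ a} : ℝ)) ≤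
            k * (Real.exp (-(s / k)) * Nat.card (V → Fin k)) := by
          refine (Finset.sum_le_card_nsmul _ _ _ fun a _ => h1 a).trans (le_of_eq ?_)
          simp
        exact le_trans (by exact_mod_cast h5) h6
      have h0 : (0 : ℝ) ≤ Nat.card (V → Fin k) := Nat.cast_nonneg _
      calc 4 * (s * d : ℝ) * Nat.card {f : V → Fin k // ∃ a, ∀ v ∈ E i, f v ≠ a}
          ≤ 4 * (s * d : ℝ) * (k * (Real.exp (-(s / k)) * Nat.card (V → Fin k))) := by gcongr
        _ = 4 * (s * d : ℝ) * (k * Real.exp (-(s / k))) * Nat.card (V → Fin k) := by ring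
        _ ≤ 1 * Nat.card (V → Fin k) := mul_le_mul_of_nonneg_right h h0
        _ = _ := one_mul _)
  refine ⟨c, fun i a => ?_⟩
  have := hc i
  push Not at this
  exact this a

/-- By Hoeffding's bound and the local lemma, some 2-coloring leaves at least `s'` vertices of each
class in every edge; the two classes then use disjoint palettes. -/
theorem double {d s s' k : ℕ} (hd : 1 ≤ d) (hs : 1 ≤ s) (hss' : 2 * s' ≤ s)
    (h : 8 * (s * d : ℝ) * Real.exp (-((s - 2 * s') ^ 2 / (2 * s))) ≤ 1)
    (hP : BoundedDegreePolychromatic d s' k) : BoundedDegreePolychromatic d s (2 * k) := by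
  classical
  refine of_card_eq fun V ι _ _ E hE hdeg => ?_
  have hs0 : (0 : ℝ) < s := by exact_mod_cast hs
  have hss : (2 * s' : ℝ) ≤ s := by exact_mod_cast hss'
  obtain ⟨f, hf⟩ := exists_coloring_of_local_lemma (K := Bool) E s d hs hd (fun i => (hE i).le)
    hdeg (fun i f => ∃ b, ((E i).filter fun v => f v = b).card < s')
    (fun i f g hfg ⟨b, hb⟩ => ⟨b, by
      rwa [← Finset.filter_congr (p := fun v => f v = b) fun v hv => by rw [hfg v hv]]⟩) (by
      intro i
      set T : ℝ := (s - 2 * s' : ℝ) with hT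
      have h1 : ∀ b : Bool,
          (Nat.card {f : V → Bool // ((E i).filter fun v => f v = b).card < s'} : ℝ) ≤
          Real.exp (-(T ^ 2 / (2 * s))) * Nat.card (V → Bool) := by
        intro b
        -- This choice minimizes the Chernoff exponent `s * l ^ 2 / 2 - l * T`.
        set l : ℝ := T / s with hl
        have hl0 : 0 ≤ l := div_nonneg (by linarith) hs0.le
        have h2 := mul_card_le_of_weight (E i)
          (fun c : Bool => if c = b then Real.exp (-l) else Real.exp l)
          (fun c => by positivity) (Real.exp (l * T))
          (fun f => ((E i).filter fun v => f v = b).card < s') (fun f hf => by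
            rw [Finset.prod_ite, Finset.prod_const, Finset.prod_const, ← Real.exp_nat_mul,
              ← Real.exp_nat_mul, ← Real.exp_add, Real.exp_le_exp]
            have h3 := Finset.card_filter_add_card_filter_not (s := E i) (fun v => f v = b)
            rw [hE i] at h3
            have h3' : (((E i).filter fun v => f v = b).card : ℝ) +
              ((E i).filter fun v => ¬ f v = b).card = s := by exact_mod_cast h3
            have hf' : (((E i).filter fun v => f v = b).card : ℝ) ≤ s' := by exact_mod_cast hf.le
            have : T ≤ ((E i).filter fun v => ¬ f v = b).card -
              ((E i).filter fun v => f v = b).card := by linarith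
            nlinarith)
        have h4 : (∑ c : Bool, if c = b then Real.exp (-l) else Real.exp l) /
            (Fintype.card Bool : ℝ) = Real.cosh l := by
          rw [Real.cosh_eq]
          cases b <;> simp [add_comm]
        rw [h4, hE i] at h2
        have h5 : Real.cosh l ^ s ≤ Real.exp (T ^ 2 / (2 * s)) := by
          calc Real.cosh l ^ s ≤ Real.exp (l ^ 2 / 2) ^ s :=
                pow_le_pow_left₀ (Real.cosh_pos l).le (Real.cosh_le_exp_half_sq l) _
            _ = Real.exp (T ^ 2 / (2 * s)) := by
                rw [← Real.exp_nat_mul]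
                congr 1
                rw [hl]
                field_simp
        have h6 : Real.exp (l * T) *
            Nat.card {f : V → Bool // ((E i).filter fun v => f v = b).card < s'} ≤
            Real.exp (T ^ 2 / (2 * s)) * Nat.card (V → Bool) :=
          h2.trans (mul_le_mul_of_nonneg_right h5 (Nat.cast_nonneg _))
        refine le_of_mul_le_mul_left (h6.trans (le_of_eq ?_)) (Real.exp_pos (l * T))
        rw [← mul_assoc, ← Real.exp_add]
        congr 2
        rw [hl]
        field_simp
        ring
      have h4 : (Nat.card {f : V → Bool // ∃ b, ((E i).filter fun v => f v = b).card < s'} : ℝ) ≤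
          2 * (Real.exp (-(T ^ 2 / (2 * s))) * Nat.card (V → Bool)) := by
        have h5 : Nat.card {f : V → Bool // ∃ b, ((E i).filter fun v => f v = b).card < s'} ≤
            ∑ b : Bool, Nat.card {f : V → Bool // ((E i).filter fun v => f v = b).card < s'} := by
          simp only [Nat.card_eq_fintype_card, Fintype.card_subtype]
          refine le_trans (Finset.card_le_card fun f hf => ?_) Finset.card_biUnion_le
          simpa only [Finset.mem_biUnion, Finset.mem_filter, Finset.mem_univ, true_and] using hf
        have h6 : (∑ b : Bool,
            (Nat.card {f : V → Bool // ((E i).filter fun v => f v = b).card < s'} : ℝ)) ≤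
            2 * (Real.exp (-(T ^ 2 / (2 * s))) * Nat.card (V → Bool)) := by
          refine (Finset.sum_le_card_nsmul _ _ _ fun a _ => h1 a).trans (le_of_eq ?_)
          simp
        exact le_trans (by exact_mod_cast h5) h6
      have h0 : (0 : ℝ) ≤ Nat.card (V → Bool) := Nat.cast_nonneg _
      calc 4 * (s * d : ℝ) * Nat.card {f : V → Bool //
              ∃ b, ((E i).filter fun v => f v = b).card < s'}
          ≤ 4 * (s * d : ℝ) * (2 * (Real.exp (-(T ^ 2 / (2 * s))) * Nat.card (V → Bool))) := by
            gcongr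
        _ = 8 * (s * d : ℝ) * Real.exp (-(T ^ 2 / (2 * s))) * Nat.card (V → Bool) := by ring
        _ ≤ 1 * Nat.card (V → Bool) := mul_le_mul_of_nonneg_right h h0
        _ = _ := one_mul _)
  have hcol : ∀ b : Bool, ∃ c : V → Fin k, ∀ i a, ∃ v ∈ (E i).filter fun v => f v = b, c v = a := by
    intro b
    refine hP V ι _ (fun i => ?_) (fun v => le_trans ?_ (hdeg v))
    · have := hf i
      push Not at this
      exact this b
    · exact Nat.card_le_card_of_injective
        (fun i : {i // v ∈ (E i).filter fun v => f v = b} =>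
          (⟨i.1, (Finset.mem_filter.1 i.2).1⟩ : {i // v ∈ E i}))
        (fun i j hij => Subtype.ext (by simpa using hij))
  choose c hc using hcol
  have e : Bool × Fin k ≃ Fin (2 * k) :=
    Fintype.equivOfCardEq (by simp)
  refine ⟨fun v => e (f v, c (f v) v), fun i a => ?_⟩
  obtain ⟨v, hv, hva⟩ := hc (e.symm a).1 i (e.symm a).2
  rw [Finset.mem_filter] at hv
  refine ⟨v, hv.1, ?_⟩
  simp only [hv.2, hva, Prod.mk.eta, Equiv.apply_symm_apply]

end BoundedDegreePolychromatic

/-! ### From strips to blocks of consecutive points. -/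

/-- If hypergraphs with edges of size `s` and degrees at most `d` have polychromatic
`k`-colorings, so do the hypergraphs of strips with `2 * s` points: sort the points in each
direction, and cut each order into consecutive blocks of size `s`. -/
theorem hasPolychromaticColorings_axisStrips {d s k : ℕ} (hs : 1 ≤ s)
    (h : BoundedDegreePolychromatic d s k) : HasPolychromaticColorings (axisStrips d) k (2 * s) := by
  classical
  intro V
  set n := V.card with hn
  have hrank : ∀ i : Fin d, ∃ r : {v // v ∈ V} ≃ Fin n, ∀ u v, r u ≤ r v → u.1 i ≤ v.1 i := by
    intro i
    let g : Fin n → ℝ := fun j => (V.equivFin.symm j).1 i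
    refine ⟨V.equivFin.trans (Tuple.sort g).symm, fun u v huv => ?_⟩
    have := Tuple.monotone_sort g huv
    simpa [g] using this
  choose r hr using hrank
  -- Only full blocks are edges; the final `n % s` points of an order lie in none.
  let E : Fin d × Fin (n / s) → Finset {v // v ∈ V} :=
    fun p => Finset.univ.filter fun v => (r p.1 v : ℕ) / s = p.2
  have hblock : ∀ p : Fin d × Fin (n / s), p.2 * s + s ≤ n := fun p => by
    have h1 : (p.2 : ℕ) + 1 ≤ n / s := p.2.2
    have h2 := (Nat.mul_le_mul_right s h1).trans (Nat.div_mul_le_self n s)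
    linarith
  obtain ⟨c, hc⟩ := h {v // v ∈ V} (Fin d × Fin (n / s)) E (fun p => by
      have hp := hblock p
      have hinj : Function.Injective fun t : Fin s =>
          (r p.1).symm ⟨p.2 * s + t, by omega⟩ := by
        intro t t' htt
        have := (r p.1).symm.injective htt
        simp only [Fin.mk.injEq] at this
        exact Fin.ext (by omega)
      have hle := Finset.card_le_card_of_injOn (s := (Finset.univ : Finset (Fin s))) (t := E p)
        _ (fun t _ => ?_) hinj.injOn
      · simpa using hle
      · simp only [E, Finset.coe_filter, Finset.mem_univ, true_and, Set.mem_ofPred_eq,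
          Equiv.apply_symm_apply]
        rw [mul_comm, Nat.mul_add_div (by omega), Nat.div_eq_of_lt t.2, add_zero])
    (fun v => by
      have := Nat.card_le_card_of_injective (fun p : {p // v ∈ E p} => p.1.1) (by
        rintro ⟨⟨i, b⟩, hp⟩ ⟨⟨j, b'⟩, hq⟩ (hij : i = j)
        subst hij
        simp only [E, Finset.mem_filter, Finset.mem_univ, true_and] at hp hq
        have : b = b' := Fin.ext (hp.symm.trans hq)
        subst this
        rfl)
      simpa using this)
  refine ⟨c, ?_⟩
  rintro e ⟨⟨R, ⟨i, a, b, rfl⟩, heR⟩, hcard⟩ col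
  have hmem : ∀ x, x ∈ e ↔ x ∈ V ∧ a ≤ x i ∧ x i ≤ b := by
    intro x
    have := Set.ext_iff.1 heR x
    simpa using this
  let I : Finset (Fin n) := Finset.univ.filter fun t => ((r i).symm t).1 ∈ e
  have hI : I.card = 2 * s := by
    rw [← hcard]
    refine Finset.card_nbij (fun t => ((r i).symm t).1) ?_ ?_ ?_
    · intro t ht
      simpa [I] using ht
    · intro t _ t' _ htt
      exact (r i).symm.injective (Subtype.ext htt)
    · intro x hx
      refine ⟨r i ⟨x, ((hmem x).1 hx).1⟩, ?_, ?_⟩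
      · simpa [I] using hx
      · simp
  have hne : I.Nonempty := Finset.card_pos.1 (by omega)
  set p := I.min' hne with hp
  set q := I.max' hne with hq
  have hpq : I ⊆ Finset.Icc p q := fun t ht =>
    Finset.mem_Icc.2 ⟨I.min'_le t ht, I.le_max' t ht⟩
  have hlen := Finset.card_le_card hpq
  rw [hI, Fin.card_Icc] at hlen
  have hpe : ((r i).symm p).1 ∈ e := by simpa [I] using I.min'_mem hne
  have hqe : ((r i).symm q).1 ∈ e := by simpa [I] using I.max'_mem hne
  have hconv : ∀ v : {v // v ∈ V}, p ≤ r i v → r i v ≤ q → v.1 ∈ e := by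
    intro v h1 h2
    have h3 := hr i ((r i).symm p) v (by simpa using h1)
    have h4 := hr i v ((r i).symm q) (by simpa using h2)
    exact (hmem v.1).2 ⟨v.2, ((hmem _).1 hpe).2.1.trans h3, h4.trans ((hmem _).1 hqe).2.2⟩
  -- Rounding `p / s` up gives the first block starting at or after `p`; it ends by `p + 2 * s - 2`,
  -- which is before `q`.
  set B := ((p : ℕ) + (s - 1)) / s with hB
  have hB1 : (p : ℕ) ≤ B * s ∧ B * s ≤ p + (s - 1) := by
    have h1 := Nat.div_add_mod ((p : ℕ) + (s - 1)) s
    have h2 := Nat.mod_lt ((p : ℕ) + (s - 1)) (show 0 < s by omega)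
    rw [← hB, mul_comm] at h1
    omega
  have hqn := q.2
  have hBn : B < n / s := by
    rw [Nat.lt_iff_add_one_le, Nat.le_div_iff_mul_le (by omega), add_mul, one_mul]
    omega
  obtain ⟨v, hv, hvc⟩ := hc (i, ⟨B, hBn⟩) col
  refine ⟨v, hconv v ?_ ?_, hvc⟩
  all_goals
    simp only [E, Finset.mem_filter, Finset.mem_univ, true_and] at hv
    have h1 := Nat.div_add_mod (r i v : ℕ) s
    have h2 := Nat.mod_lt (r i v : ℕ) (show 0 < s by omega)
    rw [hv, mul_comm] at h1
    rw [Fin.le_def]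
    omega

theorem exists_polychromaticNumber_eq {X : Type*} {R : Set (Set X)} {k m : ℕ}
    (h : HasPolychromaticColorings R k m) :
    ∃ m' : ℕ, polychromaticNumber R k = (m' : ℕ∞) ∧ m' ≤ m := by
  have hle : polychromaticNumber R k ≤ (m : ℕ∞) := sInf_le ⟨m, rfl, h⟩
  obtain ⟨m', hm'⟩ := ENat.ne_top_iff_exists.1 (ne_top_of_le_ne_top (ENat.natCast_ne_top m) hle)
  exact ⟨m', hm'.symm, by rw [← hm'] at hle; exact_mod_cast hle⟩

/-! ### Parameters and the recursion on the number of colors. -/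

namespace BoundedDegreePolychromatic

/-- The factor `k ^ 2 ≤ L ^ 16`, from the edge size and the union bound, and a further `L` from the
edge size leave `12 / L` against the gain `L ^ 18`. -/
theorem of_le_log_pow {d k : ℕ} (hd : 1 ≤ d) (hk : 1 ≤ k) (hL : 100 ≤ Real.log d)
    (hlog : 18 * Real.log (Real.log d) + 1 ≤ Real.log d) (hkL : (k : ℝ) ≤ Real.log d ^ 8) :
    BoundedDegreePolychromatic d ⌈(k : ℝ) * (Real.log d + 18 * Real.log (Real.log d))⌉₊ k := by
  set L := Real.log d with hLdef
  set s := ⌈(k : ℝ) * (L + 18 * Real.log L)⌉₊ with hs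
  have hd0 : (0 : ℝ) < d := by exact_mod_cast hd
  have hk1 : (1 : ℝ) ≤ k := by exact_mod_cast hk
  have hL0 : 0 < L := by linarith
  have hlL : 0 ≤ Real.log L := Real.log_nonneg (by linarith)
  have hx : 1 ≤ (k : ℝ) * (L + 18 * Real.log L) := by nlinarith
  have hs1 : (k : ℝ) * (L + 18 * Real.log L) ≤ s := Nat.le_ceil _
  have hs2 : (s : ℝ) ≤ k * (L + 18 * Real.log L) + 1 := (Nat.ceil_lt_add_one (by linarith)).le
  have hs3 : (s : ℝ) ≤ 3 * (k * L) := by nlinarith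
  have hs4 : 1 ≤ s := by exact_mod_cast hx.trans hs1
  refine of_mul_exp_le hd hs4 hk ?_
  have hexp : Real.exp (-(s / k)) ≤ 1 / (d * L ^ 18) := by
    have h1 : -((s : ℝ) / k) ≤ -(L + 18 * Real.log L) := by
      rw [neg_le_neg_iff, le_div_iff₀ (by linarith)]
      linarith
    refine (Real.exp_le_exp.2 h1).trans (le_of_eq ?_)
    rw [Real.exp_neg, Real.exp_add, hLdef, Real.exp_log hd0, ← hLdef, one_div]
    congr 2
    rw [show (18 : ℝ) * Real.log L = (18 : ℕ) * Real.log L by norm_num, Real.exp_nat_mul,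
      Real.exp_log hL0]
  calc 4 * (s * d : ℝ) * (k * Real.exp (-(s / k)))
      ≤ 4 * (3 * (k * L) * d : ℝ) * (k * (1 / (d * L ^ 18))) := by gcongr
    _ = 12 * k * k / L ^ 17 := by field_simp; ring
    _ ≤ 12 * L ^ 8 * L ^ 8 / L ^ 17 := by gcongr
    _ = 12 / L := by field_simp
    _ ≤ 1 := by rw [div_le_one hL0]; linarith

/-- In use, `w` is `k ^ (1 / 8)` for the target number of colors. Then `s ≤ 2 * w ^ 9`, so a gap of
`w ^ 6 / 10` makes the Hoeffding exponent of order `w ^ 3`; the needed `11 * w` covers `s * d`. -/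
theorem double_step {d s s' k : ℕ} {w M : ℝ} (hd : 1 ≤ d) (hw : 100 ≤ w)
    (hdw : Real.log d ≤ w) (hM : M ≤ 2 * w) (hs : 1 ≤ s) (hsM : (s : ℝ) ≤ w ^ 8 * M)
    (hss' : w ^ 6 / 10 ≤ (s : ℝ) - 2 * s') (hP : BoundedDegreePolychromatic d s' k) :
    BoundedDegreePolychromatic d s (2 * k) := by
  have hd0 : (0 : ℝ) < d := by exact_mod_cast hd
  have hs0 : (0 : ℝ) < s := by exact_mod_cast hs
  have hw0 : 0 < w := by linarith
  have hs2 : (s : ℝ) ≤ 2 * w ^ 9 := by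
    refine hsM.trans ?_
    have := mul_le_mul_of_nonneg_left hM (show 0 ≤ w ^ 8 by positivity)
    linarith [show w ^ 8 * (2 * w) = 2 * w ^ 9 by ring]
  have hle : 2 * s' ≤ s := by
    have : (2 * s' : ℝ) ≤ s := by linarith [show 0 ≤ w ^ 6 by positivity]
    exact_mod_cast this
  refine double hd hs hle ?_ hP
  have h1 : 11 * w ≤ ((s : ℝ) - 2 * s') ^ 2 / (2 * s) := by
    rw [le_div_iff₀ (by positivity)]
    have h2 : (w ^ 6 / 10) ^ 2 ≤ ((s : ℝ) - 2 * s') ^ 2 := pow_le_pow_left₀ (by positivity) hss' 2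
    have h3 : 11 * w * (2 * s) ≤ 11 * w * (2 * (2 * w ^ 9)) := by gcongr
    have h4 : 4400 * w ^ 10 ≤ w ^ 2 * w ^ 10 := by
      have : 4400 ≤ w ^ 2 := by nlinarith
      gcongr
    nlinarith
  have h5 : Real.exp (-(((s : ℝ) - 2 * s') ^ 2 / (2 * s))) ≤ Real.exp (-(11 * w)) :=
    Real.exp_le_exp.2 (by linarith)
  have h6 : (d : ℝ) ≤ Real.exp w := by
    rw [← Real.exp_log hd0]
    exact Real.exp_le_exp.2 hdw
  have h7 : w + 1 ≤ Real.exp w := Real.add_one_le_exp w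
  have h8 : w ^ 9 ≤ Real.exp w ^ 9 := pow_le_pow_left₀ hw0.le (by linarith) 9
  calc 8 * (s * d : ℝ) * Real.exp (-((s - 2 * s') ^ 2 / (2 * s)))
      ≤ 8 * (2 * Real.exp w ^ 9 * Real.exp w : ℝ) * Real.exp (-(11 * w)) := by
        gcongr
        linarith
    _ = 16 * Real.exp w ^ 10 / Real.exp w ^ 11 := by
        rw [Real.exp_neg, show 11 * w = (11 : ℕ) * w by norm_num, Real.exp_nat_mul]
        field_simp
        ring
    _ = 16 / Real.exp w := by
        have := Real.exp_pos w
        field_simp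
    _ ≤ 1 := by
        rw [div_le_one (Real.exp_pos w)]
        linarith

/-- The subtracted `k ^ (3 / 4)` strengthens the claim so that halving leaves room for deviation and
rounding. -/
theorem of_ceil_sub {d : ℕ} (hd : 1 ≤ d) (hL : 100 ≤ Real.log d)
    (hlog : 18 * Real.log (Real.log d) + 1 ≤ Real.log d) (k : ℕ) (hk : 1 ≤ k) :
    BoundedDegreePolychromatic d
      ⌈(k : ℝ) * (Real.log d + 18 * Real.log (Real.log d) + 1) - ((k : ℝ) ^ (1 / 8 : ℝ)) ^ 6⌉₊
      k := by
  set L := Real.log d with hLdef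
  set M := L + 18 * Real.log L + 1 with hM
  have hlL : 0 ≤ Real.log L := Real.log_nonneg (by linarith)
  have hroot : ∀ n : ℕ, ((n : ℝ) ^ (1 / 8 : ℝ)) ^ 8 = n := fun n => by
    rw [← Real.rpow_natCast, ← Real.rpow_mul (Nat.cast_nonneg n)]
    norm_num
  induction k using Nat.strong_induction_on with
  | _ k ih =>
    have hk1 : (1 : ℝ) ≤ k := by exact_mod_cast hk
    set w : ℝ := (k : ℝ) ^ (1 / 8 : ℝ) with hw
    have hw8 : w ^ 8 = k := hroot k
    have hw1 : 1 ≤ w := Real.one_le_rpow hk1 (by norm_num)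
    have hw68 : w ^ 6 ≤ w ^ 8 := pow_le_pow_right₀ hw1 (by norm_num)
    by_cases hkL : (k : ℝ) ≤ L ^ 8
    -- The `+ 1` in `M` contributes `k = w ^ 8`, which covers the subtracted `w ^ 6`.
    · refine (of_le_log_pow hd hk hL hlog hkL).mono_size (Nat.ceil_le_ceil ?_)
      rw [← hLdef, hM]
      nlinarith
    · have hLw : L ≤ w := by
        by_contra! hlt
        exact hkL (hw8 ▸ pow_le_pow_left₀ (by linarith) hlt.le 8)
      have hw100 : 100 ≤ w := hL.trans hLw
      have hk2 : 2 ≤ k := by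
        have : (1 : ℝ) < k := by
          rw [← hw8]
          exact one_lt_pow₀ (by linarith) (by norm_num)
        exact_mod_cast this
      set k' := (k + 1) / 2 with hk'
      have hk'1 : 1 ≤ k' := by omega
      have hk'lt : k' < k := by omega
      have hle : k ≤ 2 * k' := by omega
      have hle2 : 2 * k' ≤ k + 1 := by omega
      have hleR : (k : ℝ) ≤ 2 * k' := by exact_mod_cast hle
      have hle2R : (2 * k' : ℝ) ≤ k + 1 := by exact_mod_cast hle2
      have hP := ih k' hk'lt hk'1
      set w' : ℝ := (k' : ℝ) ^ (1 / 8 : ℝ) with hw'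
      have hw'8 : w' ^ 8 = k' := hroot k'
      have hk'R : (1 : ℝ) ≤ k' := by exact_mod_cast hk'1
      have hw'1 : 1 ≤ w' := Real.one_le_rpow hk'R (by norm_num)
      -- Because `0.84 ^ 4 < 1 / 2`, while `0.84 ^ 3 > 0.59` for the next bound. Twice `0.59`
      -- exceeds `1` by `0.18`: this yields the gap `w ^ 6 / 10` after rounding losses.
      have hsq : 84 / 100 * w ^ 2 ≤ w' ^ 2 := by
        by_contra! hlt
        have h1 : (w' ^ 2) ^ 4 ≤ (84 / 100 * w ^ 2) ^ 4 :=
          pow_le_pow_left₀ (by positivity) hlt.le 4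
        rw [← pow_mul, mul_pow, ← pow_mul] at h1
        norm_num at h1
        rw [hw'8, hw8] at h1
        linarith
      have h6 : 59 / 100 * w ^ 6 ≤ w' ^ 6 := by
        have h1 : (84 / 100 * w ^ 2) ^ 3 ≤ (w' ^ 2) ^ 3 := pow_le_pow_left₀ (by positivity) hsq 3
        rw [← pow_mul, mul_pow, ← pow_mul] at h1
        norm_num at h1
        linarith [show 0 ≤ w ^ 6 by positivity]
      have hw'68 : w' ^ 6 ≤ w' ^ 8 := pow_le_pow_right₀ hw'1 (by norm_num)
      have hM2 : M ≤ 2 * L := by linarith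
      have hM1 : 100 ≤ M := by linarith
      have hpos : 1 ≤ (k : ℝ) * M - w ^ 6 := by
        linarith [mul_le_mul_of_nonneg_left hM1 (show (0 : ℝ) ≤ k by linarith)]
      have hpos' : 0 ≤ (k' : ℝ) * M - w' ^ 6 := by
        linarith [mul_le_mul_of_nonneg_left hM1 (show (0 : ℝ) ≤ k' by linarith)]
      have hs1 := Nat.le_ceil ((k : ℝ) * M - w ^ 6)
      have hs2 := Nat.ceil_lt_add_one (show 0 ≤ (k : ℝ) * M - w ^ 6 by linarith)
      have hs'2 := Nat.ceil_lt_add_one hpos'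
      have hw6 : 1 ≤ w ^ 6 := one_le_pow₀ hw1
      refine mono_colors (k := 2 * k') ?_ hk hle
      refine double_step hd hw100 hLw (hM2.trans (by linarith)) ?_ (M := M) ?_ ?_ hP
      · exact_mod_cast hpos.trans hs1
      · rw [hw8]
        linarith
      · have h7 : 2 * ((k' : ℝ) * M) ≤ k * M + M := by
          linarith [mul_le_mul_of_nonneg_right hle2R (show 0 ≤ M by linarith)]
        have h9 : 10000 * w ≤ w ^ 6 := by
          have h10 : (10000 : ℝ) ≤ w ^ 2 := by nlinarith
          have : (10000 : ℝ) ≤ w ^ 5 := h10.trans (pow_le_pow_right₀ hw1 (by norm_num))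
          linarith [mul_le_mul_of_nonneg_right this (show 0 ≤ w by linarith),
            show w ^ 5 * w = w ^ 6 by ring]
        linarith

theorem exists_forall_of_ceil : ∃ D : ℕ, ∀ d : ℕ, D ≤ d → 1 ≤ d ∧ 100 ≤ Real.log d ∧
    ∀ k : ℕ, 1 ≤ k → BoundedDegreePolychromatic d
      ⌈(k : ℝ) * (Real.log d + 18 * Real.log (Real.log d) + 1)⌉₊ k := by
  have h1 : ∀ᶠ x : ℝ in Filter.atTop, 18 * Real.log x + 1 ≤ x := by
    filter_upwards [Real.isLittleO_log_id_atTop.bound (show (0 : ℝ) < 1 / 36 by norm_num),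
      Filter.eventually_ge_atTop 2] with x hx hx2
    have h0 : 0 ≤ Real.log x := Real.log_nonneg (by linarith)
    rw [Real.norm_of_nonneg h0, id, Real.norm_of_nonneg (by linarith)] at hx
    linarith
  have hlim : Filter.Tendsto (fun d : ℕ => Real.log d) Filter.atTop Filter.atTop :=
    Real.tendsto_log_atTop.comp tendsto_natCast_atTop_atTop
  obtain ⟨D, hD⟩ := Filter.eventually_atTop.1
    ((hlim.eventually (h1.and (Filter.eventually_ge_atTop 100))).and
      (Filter.eventually_ge_atTop 1))
  refine ⟨D, fun d hd => ⟨(hD d hd).2, (hD d hd).1.2, fun k hk => ?_⟩⟩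
  refine (of_ceil_sub (hD d hd).2 (hD d hd).1.2 (hD d hd).1.1 k hk).mono_size
    (Nat.ceil_le_ceil ?_)
  have : 0 ≤ ((k : ℝ) ^ (1 / 8 : ℝ)) ^ 6 := by positivity
  linarith

end BoundedDegreePolychromatic

/-! ### Small dimensions and the final constant. -/

/-- No integer `d` has `log d = 1`, and `log (log d)` increases from `d = 3` on. This lets a
constant times `|log (log d)|` absorb the finitely many small `d`. -/
theorem exists_pos_le_abs_log_log :
    ∃ c : ℝ, 0 < c ∧ ∀ d : ℕ, 2 ≤ d → c ≤ |Real.log (Real.log d)| := by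
  have h2 : Real.log 2 < 1 := Real.log_two_lt_d9.trans (by norm_num)
  have h2' : 0 < Real.log 2 := Real.log_pos (by norm_num)
  have h3 : 1 < Real.log 3 := by
    rw [Real.lt_log_iff_exp_lt (by norm_num)]
    exact Real.exp_one_lt_d9.trans (by norm_num)
  refine ⟨min |Real.log (Real.log 2)| (Real.log (Real.log 3)),
    lt_min (abs_pos.2 (Real.log_neg h2' h2).ne) (Real.log_pos h3), fun d hd => ?_⟩
  rcases hd.eq_or_lt with rfl | hd
  · exact min_le_left _ _
  · have hd3 : (3 : ℝ) ≤ d := by exact_mod_cast hd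
    refine (min_le_right _ _).trans (le_trans ?_ (le_abs_self _))
    exact Real.log_le_log (by linarith) (Real.log_le_log (by norm_num) hd3)

theorem mainTheorem4 :
    ∃ C : ℝ, ∀ d : ℕ, 2 ≤ d → ∀ k : ℕ, 2 ≤ k →
      ∃ m : ℕ, polychromaticNumber (axisStrips d) k = (m : ℕ∞) ∧
        (m : ℝ) ≤ 2 * (k : ℝ) *
          (Real.log (d : ℝ) + C * |Real.log (Real.log (d : ℝ))|) := by
  obtain ⟨D, hD⟩ := BoundedDegreePolychromatic.exists_forall_of_ceil
  obtain ⟨c, hc0, hc⟩ := exists_pos_le_abs_log_log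
  set M₀ : ℝ := Real.log D + 18 * Real.log (Real.log D) + 1 with hM₀
  have key : ∀ d k : ℕ, ∀ M : ℝ, 2 ≤ k → 1 ≤ M →
      BoundedDegreePolychromatic d ⌈(k : ℝ) * M⌉₊ k →
      ∃ m : ℕ, polychromaticNumber (axisStrips d) k = (m : ℕ∞) ∧
        (m : ℝ) ≤ 2 * (k : ℝ) * (M + 1) := by
    intro d k M hk hM h
    have hk1 : (2 : ℝ) ≤ k := by exact_mod_cast hk
    have hkM : 1 ≤ (k : ℝ) * M := by nlinarith
    have hs : 1 ≤ ⌈(k : ℝ) * M⌉₊ := Nat.one_le_ceil_iff.2 (by linarith)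
    obtain ⟨m, hm, hle⟩ :=
      exists_polychromaticNumber_eq (hasPolychromaticColorings_axisStrips hs h)
    refine ⟨m, hm, ?_⟩
    have h1 : (m : ℝ) ≤ 2 * ⌈(k : ℝ) * M⌉₊ := by exact_mod_cast hle
    have h2 := Nat.ceil_lt_add_one (show 0 ≤ (k : ℝ) * M by linarith)
    nlinarith
  have hLL : ∀ L : ℝ, 100 ≤ L → 1 ≤ Real.log L := fun L hL => by
    rw [Real.le_log_iff_exp_le (by linarith)]
    linarith [Real.exp_one_lt_d9]
  -- For large `d`, `20 = 18 + 1 + 1`: the `1` in the bound and the `1` from the ceiling are each at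
  -- most `log (log d)`. Below the threshold `D`, colorings for degree `D` are reused.
  refine ⟨max 20 ((M₀ + 1) / c), fun d hd k hk => ?_⟩
  have hk0 : (0 : ℝ) ≤ 2 * k := by positivity
  by_cases hdD : D ≤ d
  · obtain ⟨-, hL, hP⟩ := hD d hdD
    have hl := hLL _ hL
    obtain ⟨m, hm, hle⟩ := key d k _ hk (by linarith) (hP k (by omega))
    refine ⟨m, hm, hle.trans (mul_le_mul_of_nonneg_left ?_ hk0)⟩
    have h1 := mul_le_mul_of_nonneg_right (le_max_left 20 ((M₀ + 1) / c))
      (abs_nonneg (Real.log (Real.log d)))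
    rw [abs_of_nonneg (by linarith)] at h1 ⊢
    linarith
  · obtain ⟨-, hL, hP⟩ := hD D le_rfl
    have hl := hLL _ hL
    have hM1 : 1 ≤ M₀ := by linarith
    obtain ⟨m, hm, hle⟩ := key d k M₀ hk hM1 ((hP k (by omega)).mono_degree (by omega))
    refine ⟨m, hm, hle.trans (mul_le_mul_of_nonneg_left ?_ hk0)⟩
    have h1 := mul_le_mul (le_max_right 20 ((M₀ + 1) / c)) (hc d hd) hc0.le
      (le_trans (by norm_num) (le_max_left 20 ((M₀ + 1) / c)))
    rw [div_mul_cancel₀ _ hc0.ne'] at h1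
    have h2 : 0 ≤ Real.log d := Real.log_nonneg (by exact_mod_cast (by omega : 1 ≤ d))
    linarith
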